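/- Let $n \ge 1$ and let $\mathbb{H}^n$ be the $n$-dimensional hyperbolic space, realised as the Poincaré ball: the open unit ball $B \subset \mathbb{R}^n$ with the metric $g_{ij}(x) = \frac{4}{(1-|x|^2)^2}\,\delta_{ij}$; its ideal boundary $\partial_\infty \mathbb{H}^n$ is identified with the unit sphere $\partial B$. Let $\Omega \subseteq \mathbb{H}^n$ be a domain (a nonempty connected open set), and let $\partial_\infty \Omega \subseteq \partial B$ be its asymptotic boundary, that is, its boundary with respect to the cone topology on $\mathbb{H}^n \cup \partial_\infty \mathbb{H}^n$ (the topology generated by the open subsets of $\mathbb{H}^n$ and the truncated geodesic cones) minus its boundary $\partial\Omega$ in $\mathbb{H}^n$. Suppose that the $\frac{n-1}{2}$-dimensional Hausdorff measure of $\partial_\infty \Omega$ is zero. Then for every $\lambda \in \left[0, \frac{(n-1)^2}{4}\right]$ there is no bounded $\lambda$-harmonic function of $\Omega$; that is, there is no function $u$, continuous on the closure $\overline{\Omega}$ of $\Omega$ in $\mathbb{H}^n$ and of class $C^2$ in $\Omega$, that is bounded, not identically zero in $\Omega$, and satisfies $$-\Delta u = \lambda u \ \text{ in } \Omega, \qquad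 u = 0 \ \text{ on } \partial\Omega,$$ where $\Delta$ is the Laplace–Beltrami operator of $\mathbb{H}^n$. -/

import Mathlib

open scoped InnerProductSpace Topology

/-! Hyperbolic space `ℍⁿ` is the Poincaré ball model: the open unit ball
`Metric.ball 0 1` of `EuclideanSpace ℝ (Fin n)` with the metric
`g_ij (x) = 4 / (1 - ‖x‖ ^ 2) ^ 2 * δ_ij`.  Its ideal boundary `∂_∞ ℍⁿ` is the unit sphere. -/

namespace PoincareBall

noncomputable section

/-- The Riemannian metric of the Poincaré ball model, as a matrix in the standard coordinates. -/
def metric {n : ℕ} (x : EuclideanSpace ℝ (Fin n)) : Matrix (Fin n) (Fin n) ℝ :=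
  (4 / (1 - ‖x‖ ^ 2) ^ 2) • (1 : Matrix (Fin n) (Fin n) ℝ)

/-- The partial derivative in the `i`-th coordinate direction. -/
def partialDeriv {n : ℕ} (i : Fin n) (f : EuclideanSpace ℝ (Fin n) → ℝ)
    (x : EuclideanSpace ℝ (Fin n)) : ℝ :=
  fderiv ℝ f x (EuclideanSpace.single i 1)

/-- The Laplace–Beltrami operator of the hyperbolic metric,
`Δ u = (det g)^(-1/2) ∑ᵢ ∂ᵢ ((det g)^(1/2) ∑ⱼ g^{ij} ∂ⱼ u)`. -/
def hypLaplacian {n : ℕ} (u : EuclideanSpace ℝ (Fin n) → ℝ)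
    (x : EuclideanSpace ℝ (Fin n)) : ℝ :=
  (√(metric x).det)⁻¹ * ∑ i : Fin n,
    partialDeriv i
      (fun y => √(metric y).det * ∑ j : Fin n, (metric y)⁻¹ i j * partialDeriv j u y) x

/-- The hyperbolic distance of two points of the open unit ball. -/
def hypDist {n : ℕ} (x y : EuclideanSpace ℝ (Fin n)) : ℝ :=
  Real.arcosh (1 + 2 * ‖x - y‖ ^ 2 / ((1 - ‖x‖ ^ 2) * (1 - ‖y‖ ^ 2)))

/-- The hyperbolic translation of the closed ball that moves `o` to the centre `0`. Its
differential at `o` is a positive multiple of the identity, and geodesics through `0` are diameters;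
so the unit speed geodesic from `o` towards a point `x ≠ o` of the closed ball starts in the
direction of `translate o x`. -/
def translate {n : ℕ} (o x : EuclideanSpace ℝ (Fin n)) : EuclideanSpace ℝ (Fin n) :=
  (1 - 2 * ⟪o, x⟫_ℝ + ‖o‖ ^ 2 * ‖x‖ ^ 2)⁻¹ •
    ((1 - ‖o‖ ^ 2) • (x - o) - ‖x - o‖ ^ 2 • o)

/-- The truncated cone `C(o, γ₀, θ, R)` in `ℍⁿ ∪ ∂_∞ ℍⁿ` with vertex `o` and opening angle `θ`,
around the geodesic ray `γ₀` from `o` to the ideal point `z`: the points at distance greater than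
`R` from `o`, and the ideal points, that are seen from `o` at an angle less than `θ / 2`
from `z`. -/
def truncatedCone {n : ℕ} (o z : EuclideanSpace ℝ (Fin n)) (θ R : ℝ) :
    Set (EuclideanSpace ℝ (Fin n)) :=
  {x | InnerProductGeometry.angle (translate o x) (translate o z) < θ / 2 ∧
    ((‖x‖ < 1 ∧ R < hypDist o x) ∨ ‖x‖ = 1)}

/-- The cone topology on `ℍⁿ ∪ ∂_∞ ℍⁿ`, that is, on the closed unit ball: it is generated by the
open subsets of `ℍⁿ` and the truncated cones. -/
@[reducible] def coneTopology (n : ℕ) :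
    TopologicalSpace (Metric.closedBall (0 : EuclideanSpace ℝ (Fin n)) 1) :=
  TopologicalSpace.generateFrom
    ({U | ∃ V : Set (EuclideanSpace ℝ (Fin n)), IsOpen V ∧ V ⊆ Metric.ball 0 1 ∧
        U = Subtype.val ⁻¹' V} ∪
     {U | ∃ (o z : EuclideanSpace ℝ (Fin n)) (θ R : ℝ), ‖o‖ < 1 ∧ ‖z‖ = 1 ∧ 0 < θ ∧ 0 ≤ R ∧
        U = Subtype.val ⁻¹' truncatedCone o z θ R})

theorem translate_denom_pos {n : ℕ} {o x : EuclideanSpace ℝ (Fin n)} (ho : ‖o‖ < 1)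
    (hx : ‖x‖ ≤ 1) : 0 < 1 - 2 * ⟪o, x⟫_ℝ + ‖o‖ ^ 2 * ‖x‖ ^ 2 := by
  have h1 := real_inner_le_norm o x
  have h2 : ‖o‖ * ‖x‖ < 1 := by nlinarith [norm_nonneg o, norm_nonneg x]
  nlinarith [sq_nonneg (1 - ‖o‖ * ‖x‖), mul_pos (sub_pos.2 h2) (sub_pos.2 h2)]

theorem translate_ne_zero {n : ℕ} {o x : EuclideanSpace ℝ (Fin n)} (ho : ‖o‖ < 1)
    (hx : ‖x‖ ≤ 1) (hxo : x ≠ o) : translate o x ≠ 0 := by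
  have hD := translate_denom_pos ho hx
  have hd : 0 < ‖x - o‖ := norm_pos_iff.2 (sub_ne_zero.2 hxo)
  have key : ‖(1 - ‖o‖ ^ 2) • (x - o) - ‖x - o‖ ^ 2 • o‖ ^ 2 =
      ‖x - o‖ ^ 2 * (1 - 2 * ⟪o, x⟫_ℝ + ‖o‖ ^ 2 * ‖x‖ ^ 2) := by
    have e1 : ‖x - o‖ ^ 2 = ‖x‖ ^ 2 - 2 * ⟪o, x⟫_ℝ + ‖o‖ ^ 2 := by
      rw [norm_sub_sq_real, real_inner_comm]
    rw [norm_sub_sq_real, norm_smul, norm_smul, inner_smul_left, inner_smul_right,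
      inner_sub_left, real_inner_self_eq_norm_sq, real_inner_comm o x]
    simp only [mul_pow, Real.norm_eq_abs, sq_abs, e1, conj_trivial]
    ring
  unfold translate
  refine smul_ne_zero (inv_ne_zero hD.ne') fun h0 => ?_
  rw [h0] at key
  have : 0 < ‖x - o‖ ^ 2 * (1 - 2 * ⟪o, x⟫_ℝ + ‖o‖ ^ 2 * ‖x‖ ^ 2) := by positivity
  simp at key
  rcases key with h | h
  · exact hd.ne' (by simpa using h)
  · exact hD.ne' h

theorem mem_truncatedCone_iff {n : ℕ} {o z x : EuclideanSpace ℝ (Fin n)} {θ R : ℝ}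
    (ho : ‖o‖ < 1) (hR : 0 ≤ R) (hx : ‖x‖ ≤ 1) :
    x ∈ truncatedCone o z θ R ↔
      InnerProductGeometry.angle (translate o x) (translate o z) < θ / 2 ∧
      (Real.cosh R - 1) * ((1 - ‖o‖ ^ 2) * (1 - ‖x‖ ^ 2)) < 2 * ‖o - x‖ ^ 2 := by
  unfold truncatedCone
  simp only [Set.mem_ofPred_eq]
  refine and_congr_right fun _ => ?_
  have ho2 : 0 < 1 - ‖o‖ ^ 2 := by nlinarith [norm_nonneg o]
  rcases hx.lt_or_eq with h | h
  · have hx2 : 0 < 1 - ‖x‖ ^ 2 := by nlinarith [norm_nonneg x]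
    have hp := mul_pos ho2 hx2
    have h1 : R < hypDist o x ↔
        Real.cosh R < 1 + 2 * ‖o - x‖ ^ 2 / ((1 - ‖o‖ ^ 2) * (1 - ‖x‖ ^ 2)) := by
      unfold hypDist
      have hc := Real.one_le_cosh R
      rw [← Real.arcosh_lt_arcosh (x := Real.cosh R) (by linarith) (by positivity),
        Real.arcosh_cosh hR]
    simp only [h, h.ne, true_and, or_false, h1]
    rw [← sub_lt_iff_lt_add', lt_div_iff₀ hp]
  · simp only [h, lt_irrefl, false_and, false_or, true_iff]
    have : 0 < ‖o - x‖ := norm_pos_iff.2 (sub_ne_zero.2 fun h' => by rw [h'] at ho; linarith)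
    nlinarith [pow_pos this 2]

/-- The cone topology is the usual topology of the closed ball. -/
theorem coneTopology_eq (n : ℕ) : coneTopology n = instTopologicalSpaceSubtype := by
  apply le_antisymm
  · intro U hU
    obtain ⟨V, hV, rfl⟩ := isOpen_induced_iff.1 hU
    refine (@isOpen_iff_forall_mem_open _ (coneTopology n) _).2 ?_
    intro x hxV
    have hx1 : ‖(x : EuclideanSpace ℝ (Fin n))‖ ≤ 1 := mem_closedBall_zero_iff.1 x.2
    rcases hx1.lt_or_eq with h | h
    · refine ⟨Subtype.val ⁻¹' (V ∩ Metric.ball 0 1), fun y hy => hy.1,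
        TopologicalSpace.isOpen_generateFrom_of_mem
          (Or.inl ⟨_, hV.inter Metric.isOpen_ball, Set.inter_subset_right, rfl⟩), hxV, by simpa⟩
    · obtain ⟨ε, hε, hball⟩ := Metric.isOpen_iff.1 hV x hxV
      have hK : (1 : ℝ) ≤ 1 + 4 / ε := by have : 0 < 4 / ε := by positivity
                                          linarith
      have ht : ∀ y : EuclideanSpace ℝ (Fin n), translate 0 y = y := by
        intro y; simp [translate]
      refine ⟨Subtype.val ⁻¹' truncatedCone 0 x ε (Real.arcosh (1 + 4 / ε)), ?_,
        TopologicalSpace.isOpen_generateFrom_of_mem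
          (Or.inr ⟨0, x, ε, _, by simp, h, hε, Real.arcosh_nonneg hK, rfl⟩), ?_⟩
      · intro y hy
        have hy1 : ‖(y : EuclideanSpace ℝ (Fin n))‖ ≤ 1 := mem_closedBall_zero_iff.1 y.2
        have hy' := (mem_truncatedCone_iff (by simp) (Real.arcosh_nonneg hK) hy1).1 hy
        apply hball
        rw [Real.cosh_arcosh hK, ht, ht] at hy'
        obtain ⟨ha, hb⟩ := hy'
        rw [Metric.mem_ball, dist_eq_norm]
        generalize hang : InnerProductGeometry.angle (y : EuclideanSpace ℝ (Fin n)) x = a at ha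
        have ha0 : 0 ≤ a := hang ▸ InnerProductGeometry.angle_nonneg _ _
        have hcos := InnerProductGeometry.cos_angle_mul_norm_mul_norm
          (y : EuclideanSpace ℝ (Fin n)) x
        rw [hang, h, mul_one] at hcos
        have hsq := norm_sub_sq_real (y : EuclideanSpace ℝ (Fin n)) x
        rw [← hcos, h] at hsq
        have hc2 := Real.one_sub_sq_div_two_le_cos (x := a)
        have hn := norm_nonneg (y : EuclideanSpace ℝ (Fin n))
        simp only [norm_zero, zero_sub, norm_neg] at hb
        generalize ‖(y : EuclideanSpace ℝ (Fin n))‖ = r at *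
        have hb1 : 4 * (1 - r) < 2 * ε := by
          have e : (1 + 4 / ε - 1) * ((1 - 0 ^ 2) * (1 - r ^ 2)) * ε = 4 * (1 - r ^ 2) := by
            field_simp; ring
          have := mul_lt_mul_of_pos_right hb hε
          rw [e] at this
          have hr2 : r ^ 2 ≤ r := by nlinarith
          have hr3 : r ^ 2 * ε ≤ 1 * ε := mul_le_mul_of_nonneg_right (by linarith) hε.le
          linarith
        have : ‖(y : EuclideanSpace ℝ (Fin n)) - x‖ ^ 2 < ε ^ 2 := by
          rw [hsq]
          have h3 : (1 - r) ^ 2 ≤ (ε / 2) ^ 2 :=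
            pow_le_pow_left₀ (by linarith) (by linarith) 2
          have h4 : a ^ 2 ≤ (ε / 2) ^ 2 := pow_le_pow_left₀ ha0 ha.le 2
          nlinarith [mul_le_mul_of_nonneg_left hc2 hn, mul_le_mul_of_nonneg_right hy1 (sq_nonneg a)]
        exact lt_of_pow_lt_pow_left₀ 2 hε.le this
      · refine ⟨?_, Or.inr h⟩
        rw [ht, InnerProductGeometry.angle_self (fun h0 => by rw [h0] at h; simp at h)]
        linarith
  · apply le_generateFrom
    rintro U (⟨V, hV, -, rfl⟩ | ⟨o, z, θ, R, ho, hz, hθ, hR, rfl⟩)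
    · exact hV.preimage continuous_subtype_val
    · have hne : ∀ w : EuclideanSpace ℝ (Fin n), ‖w‖ ≤ 1 → w ≠ o → translate o w ≠ 0 :=
        fun w => translate_ne_zero ho
      have ho2 : 0 < 1 - ‖o‖ ^ 2 := by nlinarith [norm_nonneg o]
      rw [isOpen_iff_mem_nhds]
      intro x hx
      have hx1 : ‖(x : EuclideanSpace ℝ (Fin n))‖ ≤ 1 := mem_closedBall_zero_iff.1 x.2
      obtain ⟨ha, hb⟩ := (mem_truncatedCone_iff ho hR hx1).1 hx
      have hxo : (x : EuclideanSpace ℝ (Fin n)) ≠ o := by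
        intro h0
        rw [h0] at hb
        have := Real.one_le_cosh R
        have : 0 ≤ (Real.cosh R - 1) * ((1 - ‖o‖ ^ 2) * (1 - ‖o‖ ^ 2)) :=
          mul_nonneg (by linarith) (by positivity)
        simp at hb
        linarith
      have hzo : z ≠ o := fun h0 => by rw [h0] at hz; linarith
      have hct : ContinuousAt (translate o) (x : EuclideanSpace ℝ (Fin n)) := by
        have hD := translate_denom_pos ho hx1
        unfold translate
        have hc : Continuous fun y : EuclideanSpace ℝ (Fin n) =>
            1 - 2 * ⟪o, y⟫_ℝ + ‖o‖ ^ 2 * ‖y‖ ^ 2 := by fun_prop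
        have hc' : Continuous fun y : EuclideanSpace ℝ (Fin n) =>
            (1 - ‖o‖ ^ 2) • (y - o) - ‖y - o‖ ^ 2 • o := by fun_prop
        exact (hc.continuousAt.inv₀ hD.ne').smul hc'.continuousAt
      have c1 : ContinuousAt (fun y : Metric.closedBall (0 : EuclideanSpace ℝ (Fin n)) 1 =>
          InnerProductGeometry.angle (translate o y) (translate o z)) x := by
        have := InnerProductGeometry.continuousAt_angle
          (x := (translate o (x : EuclideanSpace ℝ (Fin n)), translate o z))
          (hne _ hx1 hxo) (hne _ hz.le hzo)
        exact ContinuousAt.comp (f := fun y : Metric.closedBall (0 : EuclideanSpace ℝ (Fin n)) 1 =>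
          (translate o (y : EuclideanSpace ℝ (Fin n)), translate o z)) this
          ((hct.comp continuousAt_subtype_val).prodMk continuousAt_const)
      have c2 : Continuous (fun y : Metric.closedBall (0 : EuclideanSpace ℝ (Fin n)) 1 =>
          (Real.cosh R - 1) *
            ((1 - ‖o‖ ^ 2) * (1 - ‖(y : EuclideanSpace ℝ (Fin n))‖ ^ 2))) := by fun_prop
      have c3 : Continuous (fun y : Metric.closedBall (0 : EuclideanSpace ℝ (Fin n)) 1 =>
          2 * ‖o - (y : EuclideanSpace ℝ (Fin n))‖ ^ 2) := by fun_prop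
      filter_upwards [c1.eventually_lt continuousAt_const ha,
        c2.continuousAt.eventually_lt c3.continuousAt hb] with y hy1 hy2
      exact (mem_truncatedCone_iff ho hR (mem_closedBall_zero_iff.1 y.2)).2 ⟨hy1, hy2⟩

/-- The asymptotic boundary `∂_∞ Ω` of a set `Ω ⊆ ℍⁿ`: its boundary for the cone topology, minus
its boundary in `ℍⁿ`. -/
def asymptoticBoundary {n : ℕ} (Ω : Set (EuclideanSpace ℝ (Fin n))) :
    Set (EuclideanSpace ℝ (Fin n)) :=
  Subtype.val '' (@frontier _ (coneTopology n)
    (Subtype.val ⁻¹' Ω : Set (Metric.closedBall (0 : EuclideanSpace ℝ (Fin n)) 1))) \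
  (frontier Ω ∩ Metric.ball 0 1)

theorem asymptoticBoundary_eq {n : ℕ} {Ω : Set (EuclideanSpace ℝ (Fin n))}
    (hΩ : Ω ⊆ Metric.ball 0 1) :
    asymptoticBoundary Ω = closure Ω ∩ Metric.sphere 0 1 := by
  have himg : ∀ A : Set (EuclideanSpace ℝ (Fin n)), A ⊆ Metric.closedBall 0 1 →
      Subtype.val '' (Subtype.val ⁻¹' A : Set (Metric.closedBall (0 : EuclideanSpace ℝ (Fin n)) 1))
        = A := fun A hA => by simpa using hA
  have hΩ' : Ω ⊆ Metric.closedBall 0 1 := hΩ.trans Metric.ball_subset_closedBall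
  unfold asymptoticBoundary
  rw [coneTopology_eq]
  ext x
  simp only [Set.mem_sdiff, Set.mem_image, Subtype.exists, exists_and_right, exists_eq_right,
    Set.mem_inter_iff, frontier_eq_closure_inter_closure]
  have hcl : ∀ hx : x ∈ Metric.closedBall (0 : EuclideanSpace ℝ (Fin n)) 1,
      (⟨x, hx⟩ : Metric.closedBall (0 : EuclideanSpace ℝ (Fin n)) 1) ∈
        closure (Subtype.val ⁻¹' Ω) ↔ x ∈ closure Ω := fun hx => by
    rw [closure_subtype, himg Ω hΩ']
  constructor
  · rintro ⟨⟨hx, h1, h2⟩, h3⟩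
    have h1' := (hcl hx).1 h1
    refine ⟨h1', ?_⟩
    by_contra hs
    have hxb : x ∈ Metric.ball (0 : EuclideanSpace ℝ (Fin n)) 1 := by
      rw [Metric.mem_ball]
      exact lt_of_le_of_ne hx hs
    refine h3 ⟨⟨h1', ?_⟩, hxb⟩
    rw [closure_subtype] at h2
    refine closure_mono ?_ h2
    rintro _ ⟨y, hy, rfl⟩
    exact hy
  · rintro ⟨h1, h2⟩
    have hx : x ∈ Metric.closedBall (0 : EuclideanSpace ℝ (Fin n)) 1 :=
      Metric.sphere_subset_closedBall h2
    have hnb : x ∉ Metric.ball (0 : EuclideanSpace ℝ (Fin n)) 1 := fun hb =>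
      (Metric.mem_ball.1 hb).ne (Metric.mem_sphere.1 h2)
    exact ⟨⟨hx, (hcl hx).2 h1, subset_closure fun h => hnb (hΩ h)⟩, fun h => hnb h.2⟩

/-- The hyperbolic Laplacian in terms of Euclidean derivatives. -/
theorem hypLaplacian_eq {n : ℕ} {u : EuclideanSpace ℝ (Fin n) → ℝ} {x : EuclideanSpace ℝ (Fin n)}
    (hx : ‖x‖ < 1) (hu : ContDiffAt ℝ 2 u x) :
    hypLaplacian u x = ((1 - ‖x‖ ^ 2) / 2) ^ 2 *
        ∑ i : Fin n, partialDeriv i (fun y => partialDeriv i u y) x +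
      ((n : ℝ) - 2) * ((1 - ‖x‖ ^ 2) / 2) * fderiv ℝ u x x := by
  set a : EuclideanSpace ℝ (Fin n) → ℝ := fun y => (1 - ‖y‖ ^ 2) / 2 with ha
  have hapos : ∀ y : EuclideanSpace ℝ (Fin n), ‖y‖ < 1 → 0 < a y := fun y hy => by
    have : ‖y‖ ^ 2 < 1 := by nlinarith [norm_nonneg y]
    simp only [ha]; linarith
  have hax := hapos x hx
  have hmet : ∀ y : EuclideanSpace ℝ (Fin n),
      metric y = ((a y) ^ 2)⁻¹ • (1 : Matrix (Fin n) (Fin n) ℝ) := fun y => by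
    unfold metric
    congr 1
    simp only [ha, div_pow, inv_div]
    norm_num
  have hdet : ∀ y : EuclideanSpace ℝ (Fin n), ‖y‖ < 1 → √(metric y).det = ((a y)⁻¹) ^ n :=
    fun y hy => by
    have := hapos y hy
    rw [hmet, Matrix.det_smul, Matrix.det_one, mul_one, Fintype.card_fin, ← inv_pow, ← pow_mul,
      mul_comm 2 n, pow_mul, Real.sqrt_sq (by positivity)]
  have hinv : ∀ y : EuclideanSpace ℝ (Fin n), ‖y‖ < 1 →
      (metric y)⁻¹ = (a y) ^ 2 • (1 : Matrix (Fin n) (Fin n) ℝ) := fun y hy => by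
    have := hapos y hy
    apply Matrix.inv_eq_left_inv
    rw [hmet, smul_mul_smul_comm, mul_one, mul_inv_cancel₀ (by positivity), one_smul]
  have hu' : DifferentiableAt ℝ (fderiv ℝ u) x :=
    (hu.fderiv_right (m := 1) (by norm_num)).differentiableAt (by norm_num)
  have hpart : ∀ i : Fin n, DifferentiableAt ℝ (fun y => partialDeriv i u y) x := fun i => by
    unfold partialDeriv
    exact hu'.clm_apply (differentiableAt_const _)
  have hev : ∀ i : Fin n, (fun y => √(metric y).det *
        ∑ j : Fin n, (metric y)⁻¹ i j * partialDeriv j u y) =ᶠ[𝓝 x]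
      fun y => (((a y)⁻¹) ^ n * (a y) ^ 2) * partialDeriv i u y := fun i => by
    have : ∀ᶠ y in 𝓝 x, ‖y‖ < 1 := (continuous_norm.tendsto x).eventually_lt_const hx
    filter_upwards [this] with y hy
    rw [hdet y hy, hinv y hy]
    simp [Matrix.one_apply, mul_assoc]
  have hda : HasFDerivAt a (-(innerSL ℝ x)) x := by
    have h1 := ((hasStrictFDerivAt_norm_sq x).hasFDerivAt.const_sub 1).mul_const (2⁻¹ : ℝ)
    refine (h1.congr_fderiv ?_).congr_of_eventuallyEq (Filter.Eventually.of_forall fun y => ?_)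
    · ext v
      simp
    · simp [ha, div_eq_mul_inv]
  have hterm : ∀ i : Fin n, partialDeriv i (fun y => √(metric y).det *
        ∑ j : Fin n, (metric y)⁻¹ i j * partialDeriv j u y) x =
      ((a x)⁻¹) ^ n * ((a x) ^ 2 * partialDeriv i (fun y => partialDeriv i u y) x +
        ((n : ℝ) - 2) * a x * (x i * partialDeriv i u x)) := fun i => by
    have hg : HasFDerivAt (fun y => ((a y)⁻¹) ^ n * (a y) ^ 2)
        ((((n : ℝ) - 2) * ((a x)⁻¹) ^ n * a x) • innerSL ℝ x) x := by
      have hD : HasDerivAt (fun t : ℝ => (t⁻¹) ^ n * t ^ 2)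
          (-(((n : ℝ) - 2) * ((a x)⁻¹) ^ n * a x)) (a x) := by
        have h := ((hasDerivAt_inv hax.ne').pow n).mul (hasDerivAt_pow 2 (a x))
        refine h.congr_deriv ?_
        rcases n with _ | m
        · simp
        · simp [pow_succ]
          field_simp
          ring
      refine (hD.comp_hasFDerivAt x hda).congr_fderiv ?_
      ext v
      simp
    have hp := (hpart i).hasFDerivAt
    have h1 := ((hg.mul hp).congr_of_eventuallyEq (hev i)).fderiv
    have h2 := congrArg (fun L => L (EuclideanSpace.single i (1 : ℝ))) h1
    refine h2.trans ?_
    simp [partialDeriv, innerSL_apply_apply, EuclideanSpace.inner_single_right]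
    ring
  have hsum : fderiv ℝ u x x = ∑ i : Fin n, x i * partialDeriv i u x := by
    have hxs : x = ∑ i : Fin n, x i • EuclideanSpace.single i (1 : ℝ) := by
      have := (EuclideanSpace.basisFun (Fin n) ℝ).sum_repr x
      simpa using this.symm
    conv_lhs => rw [show fderiv ℝ u x x =
      fderiv ℝ u x (∑ i : Fin n, x i • EuclideanSpace.single i (1 : ℝ)) by rw [← hxs]]
    simp [partialDeriv]
  unfold hypLaplacian
  rw [hdet x hx, Finset.sum_congr rfl fun i _ => hterm i, ← Finset.mul_sum, ← mul_assoc,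
    inv_mul_cancel₀ (by positivity), one_mul, Finset.sum_add_distrib, ← Finset.mul_sum,
    ← Finset.mul_sum, hsum]

/-- `u` is a `lam`-harmonic function of the domain `Ω ⊆ ℍⁿ`: it is nontrivial, continuous on the
closure of `Ω` in `ℍⁿ`, of class `C²` in `Ω`, satisfies `-Δ u = lam * u` in `Ω`, and vanishes on the
boundary of `Ω` in `ℍⁿ`. -/
structure IsLambdaHarmonic {n : ℕ} (Ω : Set (EuclideanSpace ℝ (Fin n))) (lam : ℝ)
    (u : EuclideanSpace ℝ (Fin n) → ℝ) : Prop where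
  nontrivial : ∃ x ∈ Ω, u x ≠ 0
  continuousOn : ContinuousOn u (closure Ω ∩ Metric.ball 0 1)
  contDiffOn : ContDiffOn ℝ 2 u Ω
  equation : ∀ x ∈ Ω, -hypLaplacian u x = lam * u x
  boundary : ∀ x ∈ frontier Ω ∩ Metric.ball 0 1, u x = 0

end

end PoincareBall

/-!
The proof compares a bounded `lam`-harmonic function `u` with explicit supersolutions. Let
`s = (n - 1) / 2`, so that `lam ≤ s²`. A linear function `σ` on the hyperboloid model satisfies
`Δ σ = n σ` and `|∇ σ|² = σ² + m` with a constant `m`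
(`PoincareBall.hypLaplacian_minkowskiLinear_rpow`), so powers of `σ` can be combined into
supersolutions of `Δ + s²`.

For an ideal point `ξ` and a small radius `r`, take for `σ` the multiple of `sinh` of the signed
distance to the hyperplane bounding the cap of radius `r` at `ξ`. This gives a barrier
`PoincareBall.capBarrier` that is a positive supersolution outside a neighbourhood of the cap, is
at least `1` on the boundary of that neighbourhood in `ℍⁿ`, and is `O(r ^ s)` at a fixed point `x₀`.

The asymptotic boundary of `Ω` is `K = closure Ω ∩ sphere 0 1`
(`PoincareBall.asymptoticBoundary_eq`), a compact set of `s`-dimensional Hausdorff measure zero. It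
is covered by finitely many balls with `∑ r i ^ s` as small as desired. What remains of `closure Ω`
outside the cap neighbourhoods is compact in `ℍⁿ`; there `u ≤ M ∑ capBarrier` by the maximum
principle for `u / v` (`PoincareBall.le_mul_of_strict_supersolution`,
`PoincareBall.le_mul_sum_capBarrier`), where `M` bounds `u`. Strictness comes from a multiple of
`PoincareBall.centralBarrier` that is let tend to zero. Hence `u x₀ ≤ M C ∑ r i ^ s`, so `u x₀ ≤ 0`,
and the same holds for `-u`.
-/

open scoped InnerProductSpace Topology

namespace PoincareBall

open MeasureTheory

variable {n : ℕ}

/-! ### Second derivatives along coordinate lines -/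

theorem hasDerivAt_line {f : EuclideanSpace ℝ (Fin n) → ℝ} {x e : EuclideanSpace ℝ (Fin n)} {t : ℝ}
    (hf : DifferentiableAt ℝ f (x + t • e)) :
    HasDerivAt (fun t : ℝ => f (x + t • e)) (fderiv ℝ f (x + t • e) e) t := by
  have h1 : HasDerivAt (fun t : ℝ => x + t • e) e t := by
    simpa using ((hasDerivAt_id t).smul_const e).const_add x
  exact hf.hasFDerivAt.comp_hasDerivAt t h1

theorem tendsto_line (x e : EuclideanSpace ℝ (Fin n)) :
    Filter.Tendsto (fun t : ℝ => x + t • e) (𝓝 0) (𝓝 x) := by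
  have : Continuous fun t : ℝ => x + t • e := by fun_prop
  simpa using this.tendsto 0

theorem ContDiffAt.eventually_differentiableAt {f : EuclideanSpace ℝ (Fin n) → ℝ}
    {x : EuclideanSpace ℝ (Fin n)} (hf : ContDiffAt ℝ 2 f x) :
    ∀ᶠ y in 𝓝 x, DifferentiableAt ℝ f y := by
  filter_upwards [hf.eventually (by simp)] with y hy using hy.differentiableAt (by norm_num)

theorem ContDiffAt.differentiableAt_partialDeriv {f : EuclideanSpace ℝ (Fin n) → ℝ}
    {x : EuclideanSpace ℝ (Fin n)} (hf : ContDiffAt ℝ 2 f x) (i : Fin n) :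
    DifferentiableAt ℝ (fun y => partialDeriv i f y) x := by
  have hf' : DifferentiableAt ℝ (fderiv ℝ f) x :=
    (hf.fderiv_right (m := 1) (by norm_num)).differentiableAt (by norm_num)
  exact hf'.clm_apply (differentiableAt_const _)

theorem hasDerivAt_partialDeriv_line {f : EuclideanSpace ℝ (Fin n) → ℝ}
    {x : EuclideanSpace ℝ (Fin n)} (hf : ContDiffAt ℝ 2 f x) (i : Fin n) :
    HasDerivAt (fun t : ℝ => partialDeriv i f (x + t • EuclideanSpace.single i (1 : ℝ)))
      (partialDeriv i (fun y => partialDeriv i f y) x) 0 := by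
  have h := hasDerivAt_line (f := fun y => partialDeriv i f y) (x := x)
    (e := EuclideanSpace.single i (1 : ℝ)) (t := 0)
    (by simpa using ContDiffAt.differentiableAt_partialDeriv hf i)
  simpa [partialDeriv] using h

/-- Second partial derivatives can be computed as second derivatives of the restriction to a
coordinate line. -/
theorem partialDeriv_partialDeriv_eq {f : EuclideanSpace ℝ (Fin n) → ℝ}
    {x : EuclideanSpace ℝ (Fin n)} (hf : ContDiffAt ℝ 2 f x) (i : Fin n) {g : ℝ → ℝ} {g' : ℝ}
    (h1 : ∀ᶠ t in 𝓝 (0 : ℝ),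
      HasDerivAt (fun t : ℝ => f (x + t • EuclideanSpace.single i (1 : ℝ))) (g t) t)
    (h2 : HasDerivAt g g' 0) :
    partialDeriv i (fun y => partialDeriv i f y) x = g' := by
  refine (hasDerivAt_partialDeriv_line hf i).unique (h2.congr_of_eventuallyEq ?_)
  filter_upwards [h1, (tendsto_line x (EuclideanSpace.single i (1 : ℝ))).eventually
    (ContDiffAt.eventually_differentiableAt hf)] with t ht hd
  exact (hasDerivAt_line hd).unique ht

theorem fderiv_apply_self {f : EuclideanSpace ℝ (Fin n) → ℝ} (x : EuclideanSpace ℝ (Fin n)) :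
    fderiv ℝ f x x = ∑ i : Fin n, x i * partialDeriv i f x := by
  have hxs : x = ∑ i : Fin n, x i • EuclideanSpace.single i (1 : ℝ) := by
    have := (EuclideanSpace.basisFun (Fin n) ℝ).sum_repr x
    simpa using this.symm
  conv_lhs => rw [show fderiv ℝ f x x =
    fderiv ℝ f x (∑ i : Fin n, x i • EuclideanSpace.single i (1 : ℝ)) by rw [← hxs]]
  simp [partialDeriv]

/-! ### Linearity of the Laplacian and its sign at a maximum -/

theorem hypLaplacian_add {f g : EuclideanSpace ℝ (Fin n) → ℝ} {x : EuclideanSpace ℝ (Fin n)}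
    (hx : ‖x‖ < 1) (hf : ContDiffAt ℝ 2 f x) (hg : ContDiffAt ℝ 2 g x) :
    hypLaplacian (fun y => f y + g y) x = hypLaplacian f x + hypLaplacian g x := by
  rw [hypLaplacian_eq hx hf, hypLaplacian_eq hx hg, hypLaplacian_eq hx (hf.add hg)]
  have h1 : fderiv ℝ (fun y => f y + g y) x = fderiv ℝ f x + fderiv ℝ g x :=
    fderiv_fun_add (hf.differentiableAt (by norm_num)) (hg.differentiableAt (by norm_num))
  have h2 : ∀ i : Fin n, partialDeriv i (fun y => partialDeriv i (fun y => f y + g y) y) x =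
      partialDeriv i (fun y => partialDeriv i f y) x +
        partialDeriv i (fun y => partialDeriv i g y) x := fun i => by
    refine partialDeriv_partialDeriv_eq (hf.add hg) i ?_
      ((hasDerivAt_partialDeriv_line hf i).add (hasDerivAt_partialDeriv_line hg i))
    have hl := tendsto_line x (EuclideanSpace.single i (1 : ℝ))
    filter_upwards [hl.eventually (ContDiffAt.eventually_differentiableAt hf),
      hl.eventually (ContDiffAt.eventually_differentiableAt hg)] with t h3 h4
    exact (hasDerivAt_line h3).add (hasDerivAt_line h4)
  simp only [h1, h2, Finset.sum_add_distrib, add_apply]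
  ring

theorem hypLaplacian_const_mul {f : EuclideanSpace ℝ (Fin n) → ℝ} {x : EuclideanSpace ℝ (Fin n)}
    (hx : ‖x‖ < 1) (hf : ContDiffAt ℝ 2 f x) (c : ℝ) :
    hypLaplacian (fun y => c * f y) x = c * hypLaplacian f x := by
  rw [hypLaplacian_eq hx hf, hypLaplacian_eq hx (contDiffAt_const.mul hf)]
  have h1 : fderiv ℝ (fun y => c * f y) x = c • fderiv ℝ f x :=
    fderiv_const_mul (hf.differentiableAt (by norm_num)) c
  have h2 : ∀ i : Fin n, partialDeriv i (fun y => partialDeriv i (fun y => c * f y) y) x =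
      c * partialDeriv i (fun y => partialDeriv i f y) x := fun i => by
    refine partialDeriv_partialDeriv_eq (contDiffAt_const.mul hf) i ?_
      ((hasDerivAt_partialDeriv_line hf i).const_mul c)
    have hl := tendsto_line x (EuclideanSpace.single i (1 : ℝ))
    filter_upwards [hl.eventually (ContDiffAt.eventually_differentiableAt hf)] with t h3
    exact (hasDerivAt_line h3).const_mul c
  simp only [h1, h2, ← Finset.mul_sum, smul_apply, smul_eq_mul]
  ring

theorem hypLaplacian_sum {ι : Type*} (F : Finset ι) {f : ι → EuclideanSpace ℝ (Fin n) → ℝ}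
    {x : EuclideanSpace ℝ (Fin n)} (hx : ‖x‖ < 1) (hf : ∀ i ∈ F, ContDiffAt ℝ 2 (f i) x) :
    hypLaplacian (fun y => ∑ i ∈ F, f i y) x = ∑ i ∈ F, hypLaplacian (f i) x := by
  classical
  induction F using Finset.induction_on with
  | empty =>
    simp only [Finset.sum_empty]
    simpa using hypLaplacian_const_mul hx (f := fun _ => (0 : ℝ)) contDiffAt_const 0
  | insert j F hj ih =>
    simp only [Finset.sum_insert hj]
    rw [hypLaplacian_add hx (hf j (by simp))
      (ContDiffAt.sum fun i hi => hf i (by simp [hi])), ih fun i hi => hf i (by simp [hi])]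

theorem IsLocalMax.hypLaplacian_nonpos {f : EuclideanSpace ℝ (Fin n) → ℝ}
    {x : EuclideanSpace ℝ (Fin n)} (hx : ‖x‖ < 1) (hf : ContDiffAt ℝ 2 f x)
    (hmax : IsLocalMax f x) : hypLaplacian f x ≤ 0 := by
  rw [hypLaplacian_eq hx hf, hmax.fderiv_eq_zero]
  have h2 : ∀ i : Fin n, partialDeriv i (fun y => partialDeriv i f y) x ≤ 0 := fun i => by
    by_contra! hpos
    have hl := tendsto_line x (EuclideanSpace.single i (1 : ℝ))
    have hev := hl.eventually (ContDiffAt.eventually_differentiableAt hf)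
    set φ : ℝ → ℝ := fun t => f (x + t • EuclideanSpace.single i (1 : ℝ)) with hφ
    have hd : deriv φ =ᶠ[𝓝 0]
        fun t : ℝ => partialDeriv i f (x + t • EuclideanSpace.single i (1 : ℝ)) := by
      filter_upwards [hev] with t ht using (hasDerivAt_line ht).deriv
    have hφmax : IsLocalMax φ 0 := by
      have := hl.eventually hmax
      filter_upwards [this] with t ht
      simpa [hφ] using ht
    have hdd : HasDerivAt (deriv φ) (partialDeriv i (fun y => partialDeriv i f y) x) 0 :=
      (hasDerivAt_partialDeriv_line hf i).congr_of_eventuallyEq hd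
    have hcont : ContinuousAt φ 0 := (hasDerivAt_line hev.self_of_nhds).continuousAt
    have hmin := isLocalMin_of_deriv_deriv_pos (by rw [hdd.deriv]; exact hpos)
      hφmax.deriv_eq_zero hcont
    -- a local maximum that is a local minimum too is locally constant
    have hconst : φ =ᶠ[𝓝 0] fun _ => φ 0 := by
      filter_upwards [hφmax, hmin] with t h1 h2 using le_antisymm h1 h2
    have h0 := hconst.deriv.deriv_eq
    rw [hdd.deriv] at h0
    simp at h0
    exact hpos.ne' h0
  have := Finset.sum_nonpos fun i (_ : i ∈ Finset.univ) => h2 i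
  simp only [zero_apply, mul_zero, add_zero]
  exact mul_nonpos_of_nonneg_of_nonpos (sq_nonneg _) this

/-! ### Powers of linear functions on the hyperboloid -/

/-- The restriction to `ℍⁿ` of the linear function `q X₀ - ⟪a, X'⟫` of Minkowski space
`ℝ × ℝⁿ`, where `ℍⁿ` is the hyperboloid `X₀² - ‖X'‖² = 1`, in the coordinates of the Poincaré
ball. -/
noncomputable def minkowskiLinear (q : ℝ) (a x : EuclideanSpace ℝ (Fin n)) : ℝ :=
  (q * (1 + ‖x‖ ^ 2) - 2 * ⟪a, x⟫_ℝ) / (1 - ‖x‖ ^ 2)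

theorem one_sub_norm_sq_pos {x : EuclideanSpace ℝ (Fin n)} (hx : ‖x‖ < 1) : 0 < 1 - ‖x‖ ^ 2 := by
  nlinarith [norm_nonneg x]

theorem contDiffAt_minkowskiLinear (q : ℝ) (a : EuclideanSpace ℝ (Fin n))
    {x : EuclideanSpace ℝ (Fin n)} (hx : ‖x‖ < 1) :
    ContDiffAt ℝ 2 (minkowskiLinear q a) x := by
  unfold minkowskiLinear
  have h : ContDiff ℝ 2 fun y : EuclideanSpace ℝ (Fin n) => ‖y‖ ^ 2 := contDiff_norm_sq ℝ
  have h2 : ContDiff ℝ 2 fun y : EuclideanSpace ℝ (Fin n) => ⟪a, y⟫_ℝ :=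
    contDiff_const.inner ℝ contDiff_id
  exact ((contDiff_const.mul (contDiff_const.add h)).sub
    (contDiff_const.mul h2)).contDiffAt.div (contDiff_const.sub h).contDiffAt
    (one_sub_norm_sq_pos hx).ne'

theorem contDiffAt_minkowskiLinear_rpow (q : ℝ) (a : EuclideanSpace ℝ (Fin n)) (p : ℝ)
    {x : EuclideanSpace ℝ (Fin n)} (hx : ‖x‖ < 1) (hpos : 0 < minkowskiLinear q a x) :
    ContDiffAt ℝ 2 (fun y => minkowskiLinear q a y ^ (-p)) x :=
  (contDiffAt_minkowskiLinear q a hx).rpow_const_of_ne hpos.ne'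

theorem minkowskiLinear_line (q : ℝ) (a x : EuclideanSpace ℝ (Fin n)) (i : Fin n) (t : ℝ) :
    minkowskiLinear q a (x + t • EuclideanSpace.single i (1 : ℝ)) =
      (q * (1 + (‖x‖ ^ 2 + 2 * t * x i + t ^ 2)) - 2 * (⟪a, x⟫_ℝ + t * a i)) /
        (1 - (‖x‖ ^ 2 + 2 * t * x i + t ^ 2)) := by
  have h1 : ‖x + t • EuclideanSpace.single i (1 : ℝ)‖ ^ 2 = ‖x‖ ^ 2 + 2 * t * x i + t ^ 2 := by
    rw [norm_add_sq_real, inner_smul_right, EuclideanSpace.inner_single_right, norm_smul]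
    simp
    ring
  have h2 : ⟪a, x + t • EuclideanSpace.single i (1 : ℝ)⟫_ℝ = ⟪a, x⟫_ℝ + t * a i := by
    rw [inner_add_right, inner_smul_right, EuclideanSpace.inner_single_right]
    simp
  rw [minkowskiLinear, h1, h2]

/-- For `σ = minkowskiLinear q a` one has `Δ σ = n σ` and `|∇ σ|² = σ² + m`, where
`m = ‖a‖² - q²` is the Minkowski square of the covector. Hence
`Δ σ ^ (-p) = p (p + 1) m σ ^ (-p - 2) + (p² - (n - 1) p) σ ^ (-p)`. -/
theorem hypLaplacian_minkowskiLinear_rpow (q : ℝ) (a : EuclideanSpace ℝ (Fin n)) (p : ℝ)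
    {x : EuclideanSpace ℝ (Fin n)} (hx : ‖x‖ < 1) (hpos : 0 < minkowskiLinear q a x) :
    hypLaplacian (fun y => minkowskiLinear q a y ^ (-p)) x =
      p * (p + 1) * (‖a‖ ^ 2 - q ^ 2) * minkowskiLinear q a x ^ (-p - 2) +
        (p ^ 2 - (n - 1) * p) * minkowskiLinear q a x ^ (-p) := by
  have hC := contDiffAt_minkowskiLinear_rpow q a p hx hpos
  have hρ := one_sub_norm_sq_pos hx
  rw [hypLaplacian_eq hx hC, fderiv_apply_self]
  set b := ⟪a, x⟫_ℝ with hb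
  set X := ‖x‖ ^ 2 with hX
  set ρ := 1 - X with hρ_def
  set N := q * (1 + X) - 2 * b with hN
  set σ := minkowskiLinear q a x with hσ
  have hσN : σ = N / ρ := rfl
  let S : Fin n → ℝ → ℝ := fun i t =>
    (q * (1 + (X + 2 * t * x i + t ^ 2)) - 2 * (b + t * a i)) / (1 - (X + 2 * t * x i + t ^ 2))
  let S' : Fin n → ℝ → ℝ := fun i t =>
    ((q * (2 * x i + 2 * t) - 2 * a i) * (1 - (X + 2 * t * x i + t ^ 2)) +
      (q * (1 + (X + 2 * t * x i + t ^ 2)) - 2 * (b + t * a i)) * (2 * x i + 2 * t)) /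
        (1 - (X + 2 * t * x i + t ^ 2)) ^ 2
  have hquad : ∀ (i : Fin n) (t : ℝ), HasDerivAt (fun t : ℝ => X + 2 * t * x i + t ^ 2)
      (2 * x i + 2 * t) t := fun i t => by
    have h := ((((hasDerivAt_id t).const_mul 2).mul_const (x i)).const_add X).add
      (hasDerivAt_pow 2 t)
    exact h.congr_deriv (by simp)
  have hnum : ∀ (i : Fin n) (t : ℝ), HasDerivAt
      (fun t : ℝ => q * (1 + (X + 2 * t * x i + t ^ 2)) - 2 * (b + t * a i))
      (q * (2 * x i + 2 * t) - 2 * a i) t := fun i t => by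
    have h := (((hquad i t).const_add 1).const_mul q).sub
      ((((hasDerivAt_id t).mul_const (a i)).const_add b).const_mul 2)
    exact h.congr_deriv (by simp)
  have hden : ∀ (i : Fin n) (t : ℝ), HasDerivAt
      (fun t : ℝ => 1 - (X + 2 * t * x i + t ^ 2)) (-(2 * x i + 2 * t)) t := fun i t =>
    (hquad i t).const_sub 1
  have hS : ∀ (i : Fin n) (t : ℝ), 1 - (X + 2 * t * x i + t ^ 2) ≠ 0 →
      HasDerivAt (S i) (S' i t) t := fun i t ht => by
    refine ((hnum i t).div (hden i t) ht).congr_deriv ?_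
    simp only [S']
    ring
  have hρ0 : ∀ i : Fin n, 1 - (X + 2 * 0 * x i + 0 ^ 2) = ρ := fun i => by
    simp [hρ_def]
  have hS0 : ∀ i : Fin n, S i 0 = σ := fun i => by simp [S, hσN, hN, hρ_def]
  have hS'0 : ∀ i : Fin n, S' i 0 = 2 * ((q * ρ + N) * x i - ρ * a i) / ρ ^ 2 := fun i => by
    simp only [S', hρ0]
    congr 1
    simp only [hN]
    ring
  have hline : ∀ i : Fin n,
      (fun t : ℝ => minkowskiLinear q a (x + t • EuclideanSpace.single i (1 : ℝ)) ^ (-p)) =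
        fun t => S i t ^ (-p) := fun i => by
    funext t
    rw [minkowskiLinear_line]
  have hS'' : ∀ i : Fin n, HasDerivAt (S' i)
      (2 * (q * ρ + N) / ρ ^ 2 + 8 * ((q * ρ + N) * x i - ρ * a i) * x i / ρ ^ 3) 0 := fun i => by
    have hl : HasDerivAt (fun t : ℝ => 2 * x i + 2 * t) 2 0 := by
      simpa using ((hasDerivAt_id (0 : ℝ)).const_mul 2).const_add (2 * x i)
    have h := ((((hl.const_mul q).sub_const (2 * a i)).mul (hden i 0)).add
      ((hnum i 0).mul hl)).div ((hden i 0).pow 2) (by simp only [Pi.pow_apply, hρ0]; positivity)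
    refine h.congr_deriv ?_
    have hN0 : q * (1 + (X + 2 * 0 * x i + 0 ^ 2)) - 2 * (b + 0 * a i) = N := by simp [hN]
    simp only [Pi.mul_apply, Pi.add_apply, Pi.pow_apply, hρ0, hN0]
    clear_value ρ N
    field_simp
    ring
  have hfirst : ∀ i : Fin n, ∀ᶠ t in 𝓝 (0 : ℝ),
      HasDerivAt (fun t => S i t ^ (-p)) (S' i t * (-p) * S i t ^ (-p - 1)) t ∧ 0 < S i t := by
    intro i
    have hd : ∀ᶠ t in 𝓝 (0 : ℝ), 1 - (X + 2 * t * x i + t ^ 2) ≠ 0 :=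
      (hden i 0).continuousAt.eventually_ne (by rw [hρ0]; exact hρ.ne')
    have hp : ∀ᶠ t in 𝓝 (0 : ℝ), 0 < S i t :=
      (hS i 0 (by rw [hρ0]; exact hρ.ne')).continuousAt.eventually_const_lt (by rwa [hS0])
    filter_upwards [hd, hp] with t h1 h2
    exact ⟨(hS i t h1).rpow_const (Or.inl h2.ne'), h2⟩
  have hD2 : ∀ i : Fin n, partialDeriv i (fun y => partialDeriv i
        (fun y => minkowskiLinear q a y ^ (-p)) y) x =
      p * (p + 1) * σ ^ (-p - 2) * (2 * ((q * ρ + N) * x i - ρ * a i) / ρ ^ 2) ^ 2 -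
      p * σ ^ (-p - 1) *
        (2 * (q * ρ + N) / ρ ^ 2 + 8 * ((q * ρ + N) * x i - ρ * a i) * x i / ρ ^ 3) := fun i => by
    have hSd := hS i 0 (by rw [hρ0]; exact hρ.ne')
    refine partialDeriv_partialDeriv_eq hC i (g := fun t => S' i t * (-p) * S i t ^ (-p - 1)) ?_
      ((((hS'' i).mul_const (-p)).mul
        (hSd.rpow_const (Or.inl (by rw [hS0]; exact hpos.ne')))).congr_deriv ?_)
    · rw [hline]
      filter_upwards [hfirst i] with t ht using ht.1
    · rw [hS0, hS'0, show -p - 1 - 1 = -p - 2 by ring]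
      ring
  have hD1 : ∀ i : Fin n, partialDeriv i (fun y => minkowskiLinear q a y ^ (-p)) x =
      -(p * σ ^ (-p - 1)) * (2 * ((q * ρ + N) * x i - ρ * a i) / ρ ^ 2) := fun i => by
    have h1 := hasDerivAt_line (f := fun y => minkowskiLinear q a y ^ (-p)) (x := x)
      (e := EuclideanSpace.single i (1 : ℝ)) (t := 0)
      (by simpa using hC.differentiableAt (by norm_num))
    rw [hline] at h1
    have h2 := h1.unique (hfirst i).self_of_nhds.1
    rw [hS0, hS'0] at h2
    simp only [zero_smul, add_zero] at h2
    rw [partialDeriv, h2]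
    ring
  have hxx : ∑ i : Fin n, x i * x i = X := by
    rw [hX, EuclideanSpace.real_norm_sq_eq]; simp [sq]
  have haa : ∑ i : Fin n, a i * a i = ‖a‖ ^ 2 := by
    rw [EuclideanSpace.real_norm_sq_eq]; simp [sq]
  have hax : ∑ i : Fin n, a i * x i = b := by
    rw [hb, PiLp.inner_apply]; simp [mul_comm]
  have hsum1 : ∑ i : Fin n, (2 * ((q * ρ + N) * x i - ρ * a i) / ρ ^ 2) ^ 2 =
      4 / ρ ^ 4 * ((q * ρ + N) ^ 2 * X - 2 * (q * ρ + N) * ρ * b + ρ ^ 2 * ‖a‖ ^ 2) := by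
    rw [← hxx, ← haa, ← hax]
    simp only [Finset.mul_sum, ← Finset.sum_add_distrib, ← Finset.sum_sub_distrib]
    refine Finset.sum_congr rfl fun i _ => ?_
    field_simp
    ring
  have hsum2 : ∑ i : Fin n, ((q * ρ + N) * x i - ρ * a i) * x i = (q * ρ + N) * X - ρ * b := by
    rw [← hxx, ← hax]
    simp only [Finset.mul_sum, ← Finset.sum_sub_distrib]
    refine Finset.sum_congr rfl fun i _ => ?_
    ring
  have hsum3 : ∑ i : Fin n, (2 * (q * ρ + N) / ρ ^ 2 +
      8 * ((q * ρ + N) * x i - ρ * a i) * x i / ρ ^ 3) =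
      n * (2 * (q * ρ + N) / ρ ^ 2) + 8 / ρ ^ 3 * ((q * ρ + N) * X - ρ * b) := by
    rw [← hsum2, Finset.sum_add_distrib, Finset.mul_sum]
    congr 1
    · simp
    · refine Finset.sum_congr rfl fun i _ => ?_
      ring
  have hsum4 : ∑ i : Fin n, x i * (-(p * σ ^ (-p - 1)) *
      (2 * ((q * ρ + N) * x i - ρ * a i) / ρ ^ 2)) =
      -(p * σ ^ (-p - 1)) * (2 / ρ ^ 2) * ((q * ρ + N) * X - ρ * b) := by
    rw [← hsum2, Finset.mul_sum]
    refine Finset.sum_congr rfl fun i _ => ?_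
    ring
  simp only [hD2, hD1]
  rw [Finset.sum_sub_distrib, ← Finset.mul_sum, ← Finset.mul_sum, hsum1, hsum3, hsum4]
  have e1 : σ ^ (-p - 1) = σ ^ (-p - 2) * σ := by
    rw [← Real.rpow_add_one hpos.ne']; congr 1; ring
  have e2 : σ ^ (-p) = σ ^ (-p - 2) * σ ^ 2 := by
    rw [← Real.rpow_natCast σ 2, ← Real.rpow_add hpos]; congr 1; push_cast; ring
  rw [e1, e2]
  generalize σ ^ (-p - 2) = E
  have hN2 : q * ρ + N = 2 * (q - b) := by simp only [hN, hρ_def]; ring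
  have hXρ : X = 1 - ρ := by simp [hρ_def]
  rw [hN2, hσN, hN, hXρ]
  field_simp
  ring

/-! ### Comparison with a strict supersolution -/

/-- At an interior maximum of `u / v` with value `μ`, the function `u - μ v` has a local maximum,
which `Δ v + c v < 0` excludes if `μ > 0` and `lam ≤ c`. So a bound `u ≤ M v` holds on all of `S` as
soon as it holds where the differential (in)equalities are not available. -/
theorem le_mul_of_strict_supersolution {S : Set (EuclideanSpace ℝ (Fin n))} (hS : IsCompact S)
    (hSB : S ⊆ Metric.ball 0 1) {u v : EuclideanSpace ℝ (Fin n) → ℝ} (hu : ContinuousOn u S)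
    (hv : ContinuousOn v S) (hvpos : ∀ x ∈ S, 0 < v x) {lam c M : ℝ} (hlam : lam ≤ c) (hM : 0 ≤ M)
    (h : ∀ x ∈ S, u x ≤ M * v x ∨ (S ∈ 𝓝 x ∧ ContDiffAt ℝ 2 u x ∧ ContDiffAt ℝ 2 v x ∧
      -hypLaplacian u x = lam * u x ∧ hypLaplacian v x + c * v x < 0)) :
    ∀ x ∈ S, u x ≤ M * v x := by
  intro y hy
  obtain ⟨x, hxS, hmax⟩ := hS.exists_isMaxOn ⟨y, hy⟩ (hu.div hv fun z hz => (hvpos z hz).ne')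
  have hvx := hvpos x hxS
  set μ := u x / v x with hμ
  have hle : ∀ z ∈ S, u z ≤ μ * v z := fun z hz => (div_le_iff₀ (hvpos z hz)).1 (hmax hz)
  have hux : u x = μ * v x := by rw [hμ]; field_simp
  rcases le_or_gt μ M with hμM | hμM
  · exact (hle y hy).trans (mul_le_mul_of_nonneg_right hμM (hvpos y hy).le)
  exfalso
  have hμ0 : 0 < μ := hM.trans_lt hμM
  rcases h x hxS with h1 | ⟨hnhds, hcu, hcv, hequ, hv2⟩
  · rw [hux] at h1
    exact absurd (le_of_mul_le_mul_right h1 hvx) (not_le.2 hμM)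
  have hx1 : ‖x‖ < 1 := mem_ball_zero_iff.1 (hSB hxS)
  have hloc : IsLocalMax (fun z => u z + -μ * v z) x := by
    filter_upwards [hnhds] with z hz
    have := hle z hz
    rw [hux]
    linarith
  have hcv' : ContDiffAt ℝ 2 (fun z => -μ * v z) x := contDiffAt_const.mul hcv
  have hnonpos := IsLocalMax.hypLaplacian_nonpos hx1 (hcu.add hcv') hloc
  rw [hypLaplacian_add hx1 hcu hcv', hypLaplacian_const_mul hx1 hcv] at hnonpos
  have h3 := mul_lt_mul_of_pos_left hv2 hμ0
  have h4 : lam * (μ * v x) ≤ c * (μ * v x) := mul_le_mul_of_nonneg_right hlam (by positivity)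
  rw [hux] at hequ
  linarith

/-! ### Barriers at ideal points -/

/-- The threshold for `capFunction ξ r / r` beyond which `capBarrier s ξ r` is a positive
supersolution. -/
noncomputable def barrierRatio (s : ℝ) : ℝ := 1 + 2 * (s * (s + 1))

/-- The function `(‖x - ξ‖² - (r² / 2) (1 + ‖x‖²)) / (1 - ‖x‖²)`, for an ideal point `ξ`. It is a
constant multiple of `sinh` of the signed distance to the hyperbolic hyperplane whose ideal points
are those at Euclidean distance `r` from `ξ`; it is negative on the side of `ξ`. -/
noncomputable def capFunction (ξ : EuclideanSpace ℝ (Fin n)) (r : ℝ) :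
    EuclideanSpace ℝ (Fin n) → ℝ :=
  minkowskiLinear (1 - r ^ 2 / 2) ξ

/-- With `τ = capFunction ξ r`, a multiple of `τ ^ (-s) - r s (s + 1) τ ^ (-s - 1)`. On
`{τ ≥ barrierRatio s * r}` it is a positive supersolution of `Δ + s²`, where `s = (n - 1) / 2`. The
factor makes it at least `1` on `{τ = barrierRatio s * r}`; away from `ξ` it is `O(r ^ s)`. -/
noncomputable def capBarrier (s : ℝ) (ξ : EuclideanSpace ℝ (Fin n)) (r : ℝ)
    (x : EuclideanSpace ℝ (Fin n)) : ℝ :=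
  2 * (barrierRatio s * r) ^ s *
    (capFunction ξ r x ^ (-s) + -(r * (s * (s + 1))) * capFunction ξ r x ^ (-(s + 1)))

theorem one_le_barrierRatio {s : ℝ} (hs : 0 ≤ s) : 1 ≤ barrierRatio s := by
  have : 0 ≤ s * (s + 1) := by positivity
  rw [barrierRatio]; linarith

theorem contDiffAt_capBarrier (s : ℝ) (ξ : EuclideanSpace ℝ (Fin n)) (r : ℝ)
    {x : EuclideanSpace ℝ (Fin n)} (hx : ‖x‖ < 1) (hpos : 0 < capFunction ξ r x) :
    ContDiffAt ℝ 2 (capBarrier s ξ r) x :=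
  contDiffAt_const.mul ((contDiffAt_minkowskiLinear_rpow _ _ _ hx hpos).add
    (contDiffAt_const.mul (contDiffAt_minkowskiLinear_rpow _ _ _ hx hpos)))

theorem capBarrier_eq {s : ℝ} (ξ : EuclideanSpace ℝ (Fin n)) (r : ℝ)
    {x : EuclideanSpace ℝ (Fin n)} (hpos : 0 < capFunction ξ r x) :
    capBarrier s ξ r x = (barrierRatio s * r) ^ s * capFunction ξ r x ^ (-s) *
      (2 * (1 - r * (s * (s + 1)) / capFunction ξ r x)) := by
  rw [capBarrier, neg_add, ← sub_eq_add_neg (-s) 1, Real.rpow_sub_one hpos.ne']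
  ring

theorem one_le_two_mul_one_sub {s r τ : ℝ} (hs : 0 ≤ s) (hr : 0 < r) (hτ : barrierRatio s * r ≤ τ) :
    1 ≤ 2 * (1 - r * (s * (s + 1)) / τ) := by
  have h1 := one_le_barrierRatio hs
  have hτ0 : 0 < τ := lt_of_lt_of_le (by positivity) hτ
  have : r * (s * (s + 1)) / τ ≤ 1 / 2 := by
    rw [div_le_iff₀ hτ0]
    rw [barrierRatio] at hτ
    linarith
  linarith

theorem capFunction_pos_of_le {s r : ℝ} (hs : 0 ≤ s) (hr : 0 < r) {ξ x : EuclideanSpace ℝ (Fin n)}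
    (hτ : barrierRatio s * r ≤ capFunction ξ r x) : 0 < capFunction ξ r x := by
  have := one_le_barrierRatio hs
  exact lt_of_lt_of_le (by positivity) hτ

theorem capBarrier_pos {s r : ℝ} (hs : 0 ≤ s) (hr : 0 < r) {ξ x : EuclideanSpace ℝ (Fin n)}
    (hτ : barrierRatio s * r ≤ capFunction ξ r x) : 0 < capBarrier s ξ r x := by
  have hpos := capFunction_pos_of_le hs hr hτ
  have h1 := one_le_two_mul_one_sub hs hr hτ
  have h2 := one_le_barrierRatio hs
  rw [capBarrier_eq ξ r hpos]
  have : 0 < (barrierRatio s * r) ^ s := Real.rpow_pos_of_pos (by positivity) _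
  have : 0 < capFunction ξ r x ^ (-s) := Real.rpow_pos_of_pos hpos _
  exact mul_pos (by positivity) (by linarith)

theorem one_le_capBarrier {s r : ℝ} (hs : 0 ≤ s) (hr : 0 < r) {ξ x : EuclideanSpace ℝ (Fin n)}
    (hτ : capFunction ξ r x = barrierRatio s * r) : 1 ≤ capBarrier s ξ r x := by
  have hpos := capFunction_pos_of_le hs hr hτ.ge
  rw [capBarrier_eq ξ r hpos, ← hτ, ← Real.rpow_add hpos, add_neg_cancel, Real.rpow_zero, one_mul]
  exact one_le_two_mul_one_sub hs hr hτ.ge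

theorem capBarrier_le {s r : ℝ} (hs : 0 ≤ s) (hr : 0 < r) {ξ x : EuclideanSpace ℝ (Fin n)}
    (hpos : 0 < capFunction ξ r x) :
    capBarrier s ξ r x ≤ 2 * barrierRatio s ^ s * capFunction ξ r x ^ (-s) * r ^ s := by
  have h2 := one_le_barrierRatio hs
  rw [capBarrier_eq ξ r hpos, Real.mul_rpow (by positivity) hr.le]
  have h3 : 0 < capFunction ξ r x ^ (-s) := Real.rpow_pos_of_pos hpos _
  have h4 : 0 ≤ r * (s * (s + 1)) / capFunction ξ r x := by positivity
  have h5 : 0 ≤ barrierRatio s ^ s * r ^ s * capFunction ξ r x ^ (-s) := by positivity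
  nlinarith [mul_le_mul_of_nonneg_left (show 2 * (1 - r * (s * (s + 1)) / capFunction ξ r x) ≤ 2
    by linarith) h5]

/-- The power `τ ^ (-s)` alone fails to be a supersolution by `s (s + 1) m τ ^ (-s - 2)`, where
`0 ≤ m ≤ r²`. The Laplacian of the correction `-r s (s + 1) τ ^ (-s - 1)` absorbs this for `τ ≥ r`,
as `s + 1` differs from the double characteristic exponent `s`. -/
theorem hypLaplacian_capBarrier_add_le {s r : ℝ} (hsn : 2 * s = n - 1) (hs : 0 ≤ s) (hr : 0 < r)
    (hr1 : r ≤ 1) {ξ x : EuclideanSpace ℝ (Fin n)} (hξ : ‖ξ‖ = 1) (hx : ‖x‖ < 1)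
    (hτ : barrierRatio s * r ≤ capFunction ξ r x) :
    hypLaplacian (capBarrier s ξ r) x + s ^ 2 * capBarrier s ξ r x ≤ 0 := by
  have hpos := capFunction_pos_of_le hs hr hτ
  have hA := one_le_barrierRatio hs
  have hpos' : 0 < minkowskiLinear (1 - r ^ 2 / 2) ξ x := hpos
  have hc1 := contDiffAt_minkowskiLinear_rpow (1 - r ^ 2 / 2) ξ s hx hpos
  have hc2 := contDiffAt_minkowskiLinear_rpow (1 - r ^ 2 / 2) ξ (s + 1) hx hpos
  have hL : hypLaplacian (capBarrier s ξ r) x = _ :=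
    hypLaplacian_const_mul hx (hc1.add (contDiffAt_const.mul hc2)) (2 * (barrierRatio s * r) ^ s)
  rw [hL, hypLaplacian_add hx hc1 (contDiffAt_const.mul hc2), hypLaplacian_const_mul hx hc2,
    hypLaplacian_minkowskiLinear_rpow _ _ _ hx hpos,
    hypLaplacian_minkowskiLinear_rpow _ _ _ hx hpos, capBarrier, capFunction, hξ]
  rw [capFunction] at hτ
  set τ := minkowskiLinear (1 - r ^ 2 / 2) ξ x
  have hn : (n : ℝ) - 1 = 2 * s := hsn.symm
  rw [hn]
  -- after extracting the lowest power of `τ`, the inequality is polynomial in `τ`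
  have e1 : τ ^ (-s) = τ ^ (-(s + 1) - 2) * τ ^ 3 := by
    rw [← Real.rpow_natCast τ 3, ← Real.rpow_add hpos']; congr 1; push_cast; ring
  have e2 : τ ^ (-(s + 1)) = τ ^ (-(s + 1) - 2) * τ ^ 2 := by
    rw [← Real.rpow_natCast τ 2, ← Real.rpow_add hpos']; congr 1; push_cast; ring
  have e3 : τ ^ (-s - 2) = τ ^ (-(s + 1) - 2) * τ := by
    rw [← Real.rpow_add_one hpos'.ne']; congr 1; ring
  rw [e1, e2, e3]
  have hE : 0 < τ ^ (-(s + 1) - 2) := Real.rpow_pos_of_pos hpos' _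
  generalize τ ^ (-(s + 1) - 2) = E at hE
  have hB : 0 ≤ (barrierRatio s * r) ^ s := Real.rpow_nonneg (by positivity) _
  generalize (barrierRatio s * r) ^ s = B at hB
  have hm0 : 0 ≤ 1 ^ 2 - (1 - r ^ 2 / 2) ^ 2 := by
    have h1 : r ^ 2 ≤ 1 := pow_le_one₀ hr.le hr1
    nlinarith [mul_nonneg (sq_nonneg r) (show (0 : ℝ) ≤ 1 - r ^ 2 / 4 by linarith)]
  have hm1 : 1 ^ 2 - (1 - r ^ 2 / 2) ^ 2 ≤ r * τ := by
    nlinarith [sq_nonneg (r ^ 2), hτ, mul_le_mul_of_nonneg_left hτ hr.le,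
      mul_le_mul_of_nonneg_right hA (sq_nonneg r)]
  generalize (1 : ℝ) ^ 2 - (1 - r ^ 2 / 2) ^ 2 = m at hm0 hm1
  have hk : 0 ≤ s * (s + 1) := by positivity
  have key : B * E * (s * (s + 1)) * (τ * (m - r * τ) - r * ((s + 1) * (s + 2)) * m) ≤ 0 := by
    apply mul_nonpos_of_nonneg_of_nonpos (by positivity)
    have : τ * (m - r * τ) ≤ 0 := mul_nonpos_of_nonneg_of_nonpos hpos'.le (by linarith)
    have : 0 ≤ r * ((s + 1) * (s + 2)) * m := by positivity
    linarith
  linarith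

/-! ### A strict supersolution on compact sets -/

theorem one_le_minkowskiLinear_one_zero {x : EuclideanSpace ℝ (Fin n)} (hx : ‖x‖ < 1) :
    1 ≤ minkowskiLinear 1 0 x := by
  have := one_sub_norm_sq_pos hx
  rw [minkowskiLinear, le_div_iff₀ this, inner_zero_left]
  nlinarith [sq_nonneg ‖x‖]

/-- The function `C X₀ ^ (-s) - X₀`, where `X₀ = minkowskiLinear 1 0` is `cosh` of the hyperbolic
distance to the centre. The term `-X₀` makes it a strict supersolution of `Δ + s²` even for `s = 0`,
that is, in dimension one. Both terms are powers `X₀ ^ (-p)`, with `p = s` and `p = -1`. -/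
noncomputable def centralBarrier (s C : ℝ) (x : EuclideanSpace ℝ (Fin n)) : ℝ :=
  C * minkowskiLinear 1 0 x ^ (-s) + -1 * minkowskiLinear 1 0 x ^ (-(-1 : ℝ))

theorem contDiffAt_centralBarrier (s C : ℝ) {x : EuclideanSpace ℝ (Fin n)} (hx : ‖x‖ < 1) :
    ContDiffAt ℝ 2 (centralBarrier s C) x := by
  have hpos : 0 < minkowskiLinear 1 0 x := one_pos.trans_le (one_le_minkowskiLinear_one_zero hx)
  exact (contDiffAt_const.mul (contDiffAt_minkowskiLinear_rpow _ _ _ hx hpos)).add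
    (contDiffAt_const.mul (contDiffAt_minkowskiLinear_rpow _ _ _ hx hpos))

theorem hypLaplacian_centralBarrier_add_lt {s C : ℝ} (hsn : 2 * s = n - 1) (hs : 0 ≤ s)
    (hC : 0 ≤ C) {x : EuclideanSpace ℝ (Fin n)} (hx : ‖x‖ < 1) :
    hypLaplacian (centralBarrier s C) x + s ^ 2 * centralBarrier s C x < 0 := by
  have hpos : 0 < minkowskiLinear 1 0 x := one_pos.trans_le (one_le_minkowskiLinear_one_zero hx)
  have hc1 := contDiffAt_minkowskiLinear_rpow 1 0 s hx hpos
  have hc2 := contDiffAt_minkowskiLinear_rpow 1 0 (-1) hx hpos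
  have hL : hypLaplacian (centralBarrier s C) x = _ :=
    hypLaplacian_add hx (contDiffAt_const.mul hc1) (contDiffAt_const.mul hc2)
  rw [hL, hypLaplacian_const_mul hx hc1, hypLaplacian_const_mul hx hc2,
    hypLaplacian_minkowskiLinear_rpow _ _ _ hx hpos,
    hypLaplacian_minkowskiLinear_rpow _ _ _ hx hpos, centralBarrier, norm_zero]
  have hn : (n : ℝ) - 1 = 2 * s := hsn.symm
  rw [hn, neg_neg, Real.rpow_one]
  have h1 : 0 < minkowskiLinear 1 0 x ^ (-s - 2) := Real.rpow_pos_of_pos hpos _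
  have h2 : 0 ≤ C * (s * (s + 1)) * minkowskiLinear 1 0 x ^ (-s - 2) := by positivity
  have h3 : 0 < (1 + s) ^ 2 * minkowskiLinear 1 0 x := by positivity
  nlinarith

theorem exists_centralBarrier_pos {S : Set (EuclideanSpace ℝ (Fin n))} (hS : IsCompact S)
    (hSB : S ⊆ Metric.ball 0 1) (s : ℝ) :
    ∃ C : ℝ, 0 ≤ C ∧ ∀ x ∈ S, 0 < centralBarrier s C x := by
  have hpos : ∀ x ∈ S, 0 < minkowskiLinear 1 0 x := fun x hx =>
    one_pos.trans_le (one_le_minkowskiLinear_one_zero (mem_ball_zero_iff.1 (hSB hx)))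
  have hcont : ContinuousOn (fun x => minkowskiLinear 1 0 x ^ (s + 1)) S := fun x hx =>
    ((contDiffAt_minkowskiLinear 1 0 (mem_ball_zero_iff.1 (hSB hx))).continuousAt.rpow_const
      (Or.inl (hpos x hx).ne')).continuousWithinAt
  obtain ⟨C, hC⟩ := hS.bddAbove_image hcont
  refine ⟨max C 0 + 1, by positivity, fun x hx => ?_⟩
  have h1 : minkowskiLinear 1 0 x ^ (s + 1) ≤ C := hC (Set.mem_image_of_mem _ hx)
  have h2 : 0 < minkowskiLinear 1 0 x ^ (-s) := Real.rpow_pos_of_pos (hpos x hx) _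
  have h3 : minkowskiLinear 1 0 x =
      minkowskiLinear 1 0 x ^ (s + 1) * minkowskiLinear 1 0 x ^ (-s) := by
    rw [← Real.rpow_add (hpos x hx)]; simp
  rw [centralBarrier, neg_neg, Real.rpow_one]
  have h4 := mul_lt_mul_of_pos_right (show minkowskiLinear 1 0 x ^ (s + 1) < max C 0 + 1 by
    linarith [le_max_left C 0]) h2
  rw [← h3] at h4
  linarith

/-! ### Covering compact sets of Hausdorff measure zero -/

/-- For `s = 0` the measure is the counting measure, so `K` is empty and no ball is needed. -/
theorem exists_finite_ball_cover {E : Type*} [MetricSpace E] [Nonempty E] [MeasurableSpace E]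
    [BorelSpace E]
    {s : ℝ} (hs : 0 ≤ s) {K : Set E} (hK : IsCompact K) (h0 : Measure.hausdorffMeasure s K = 0)
    {ε δ : ℝ} (hε : 0 < ε) (hδ : 0 < δ) :
    ∃ (F : Finset ℕ) (ξ : ℕ → E) (r : ℕ → ℝ), (∀ i ∈ F, ξ i ∈ K ∧ 0 < r i ∧ r i < δ) ∧
      (K ⊆ ⋃ i ∈ F, Metric.ball (ξ i) (r i)) ∧ ∑ i ∈ F, r i ^ s < ε := by
  classical
  rcases K.eq_empty_or_nonempty with rfl | ⟨ξ₀, hξ₀⟩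
  · exact ⟨∅, fun _ => Classical.arbitrary E, fun _ => 0, by simp, by simp, by simpa⟩
  rcases hs.eq_or_lt with rfl | hs
  · exfalso
    have := measure_mono_null (Set.singleton_subset_iff.2 hξ₀) h0
    simp [Measure.hausdorffMeasure_zero_singleton] at this
  -- as `r i ^ s` is at most the sum, the bound `δ ^ s` for the sum makes all radii less than `δ`
  set ε' : ℝ := min ε (δ ^ s) with hε'
  have hδs : 0 < δ ^ s := Real.rpow_pos_of_pos hδ s
  have hε'0 : 0 < ε' := lt_min hε hδs
  have hhalf : ENNReal.ofReal (ε' / 2) ≠ 0 := by simpa using hε'0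
  rw [Measure.hausdorffMeasure_apply] at h0
  have h1 := (ENNReal.iSup_eq_zero.1 (ENNReal.iSup_eq_zero.1 h0 1)) one_pos
  have h2 := h1.trans_lt (pos_iff_ne_zero.2 hhalf)
  simp only [iInf_lt_iff] at h2
  obtain ⟨t, ht, -, hsum⟩ := h2
  obtain ⟨e, he, hesum⟩ := ENNReal.exists_pos_sum_of_countable hhalf ℕ
  set b : ℕ → ENNReal := fun j => (⨆ _ : (t j).Nonempty, Metric.ediam (t j) ^ s) + e j with hb
  have hbsum : ∑' j, b j < ENNReal.ofReal ε' := by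
    rw [hb, ENNReal.tsum_add]
    refine (ENNReal.add_lt_add hsum hesum).trans_eq ?_
    rw [← ENNReal.ofReal_add (by positivity) (by positivity), add_halves]
  have hbfin : ∀ j, b j ≠ ⊤ := fun j =>
    ((ENNReal.le_tsum j).trans_lt (hbsum.trans ENNReal.ofReal_lt_top)).ne
  have hbpos : ∀ j, 0 < (b j).toReal := fun j => by
    refine ENNReal.toReal_pos (fun h => ?_) (hbfin j)
    have := (add_eq_zero.1 h).2
    simp at this
    exact (he j).ne' this
  have hfin : ∀ F : Finset ℕ, ∑ j ∈ F, (b j).toReal < ε' := fun F => by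
    rw [← ENNReal.toReal_sum fun j _ => hbfin j]
    exact ENNReal.toReal_lt_of_lt_ofReal ((ENNReal.sum_le_tsum F).trans_lt hbsum)
  set r : ℕ → ℝ := fun j => (b j).toReal ^ s⁻¹ with hr
  have hrs : ∀ j, r j ^ s = (b j).toReal := fun j => Real.rpow_inv_rpow (hbpos j).le hs.ne'
  have hrpos : ∀ j, 0 < r j := fun j => Real.rpow_pos_of_pos (hbpos j) _
  have hξ : ∀ j, ∃ y ∈ K, (t j ∩ K).Nonempty → y ∈ t j := fun j => by
    by_cases h : (t j ∩ K).Nonempty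
    · exact ⟨h.some, h.some_mem.2, fun _ => h.some_mem.1⟩
    · exact ⟨ξ₀, hξ₀, fun h' => absurd h' h⟩
  choose ξ hξK hξt using hξ
  obtain ⟨F, hF⟩ := hK.elim_finite_subcover (fun j => Metric.ball (ξ j) (r j))
    (fun j => Metric.isOpen_ball) fun y hy => by
      obtain ⟨j, hj⟩ := Set.mem_iUnion.1 (ht hy)
      refine Set.mem_iUnion.2 ⟨j, ?_⟩
      have hle : edist y (ξ j) ≤ Metric.ediam (t j) :=
        Metric.edist_le_ediam_of_mem hj (hξt j ⟨y, hj, hy⟩)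
      have hlt : edist y (ξ j) ^ s < b j := by
        have hne : (t j).Nonempty := ⟨y, hj⟩
        have h3 : edist y (ξ j) ^ s ≤ Metric.ediam (t j) ^ s := ENNReal.rpow_le_rpow hle hs.le
        have h4 : b j = Metric.ediam (t j) ^ s + e j := by simp [hb, hne]
        rw [h4]
        refine h3.trans_lt (ENNReal.lt_add_right (fun h => hbfin j (by rw [h4, h]; simp)) ?_)
        simpa using (he j).ne'
      have h5 : dist y (ξ j) ^ s < r j ^ s := by
        rw [hrs, dist_edist, ENNReal.toReal_rpow]
        exact (ENNReal.toReal_lt_toReal hlt.ne_top (hbfin j)).2 hlt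
      exact (Real.rpow_lt_rpow_iff dist_nonneg (hrpos j).le hs).1 h5
  refine ⟨F, ξ, r, fun j _ => ⟨hξK j, hrpos j, ?_⟩, hF, ?_⟩
  · refine (Real.rpow_lt_rpow_iff (hrpos j).le hδ.le hs).1 ?_
    have := hfin {j}
    rw [Finset.sum_singleton] at this
    rw [hrs]
    exact this.trans_le (min_le_right _ _)
  · simp only [hrs]
    exact (hfin F).trans_le (min_le_left _ _)

/-! ### Comparison on the complement of the caps -/

/-- A Euclidean open set that meets the unit ball in `{capFunction ξ r < barrierRatio s * r}`, and
that contains the part of the unit sphere at distance less than `r` from `ξ`. -/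
def capNhd (s : ℝ) (ξ : EuclideanSpace ℝ (Fin n)) (r : ℝ) : Set (EuclideanSpace ℝ (Fin n)) :=
  {y | (1 - r ^ 2 / 2) * (1 + ‖y‖ ^ 2) - 2 * ⟪ξ, y⟫_ℝ < barrierRatio s * r * (1 - ‖y‖ ^ 2)}

theorem isOpen_capNhd (s : ℝ) (ξ : EuclideanSpace ℝ (Fin n)) (r : ℝ) : IsOpen (capNhd s ξ r) :=
  isOpen_lt (by fun_prop) (by fun_prop)

theorem notMem_capNhd_iff {s r : ℝ} {ξ x : EuclideanSpace ℝ (Fin n)} (hx : ‖x‖ < 1) :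
    x ∉ capNhd s ξ r ↔ barrierRatio s * r ≤ capFunction ξ r x := by
  rw [capFunction, minkowskiLinear, le_div_iff₀ (one_sub_norm_sq_pos hx), ← not_lt]
  rfl

theorem mem_capNhd_of_mem_ball {s r : ℝ} {ξ y : EuclideanSpace ℝ (Fin n)} (hξ : ‖ξ‖ = 1)
    (hy : ‖y‖ = 1) (hyr : y ∈ Metric.ball ξ r) : y ∈ capNhd s ξ r := by
  rw [Metric.mem_ball, dist_eq_norm] at hyr
  have h1 : ‖y - ξ‖ ^ 2 < r ^ 2 := pow_lt_pow_left₀ hyr (norm_nonneg _) (by norm_num)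
  rw [norm_sub_sq_real, hξ, hy, real_inner_comm] at h1
  change (1 - r ^ 2 / 2) * (1 + ‖y‖ ^ 2) - 2 * ⟪ξ, y⟫_ℝ < barrierRatio s * r * (1 - ‖y‖ ^ 2)
  rw [hy]
  linarith

theorem le_capFunction {r : ℝ} {ξ x : EuclideanSpace ℝ (Fin n)} (hξ : ‖ξ‖ = 1) (hx : ‖x‖ < 1)
    (hr0 : 0 ≤ r) (hr : r ≤ (1 - ‖x‖) / 2) : (1 - ‖x‖) ^ 2 / 2 ≤ capFunction ξ r x := by
  rw [capFunction, minkowskiLinear, le_div_iff₀ (one_sub_norm_sq_pos hx)]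
  have h1 := real_inner_le_norm ξ x
  rw [hξ, one_mul] at h1
  have h0 := norm_nonneg x
  generalize ‖x‖ = t at *
  have h2 : r ^ 2 ≤ ((1 - t) / 2) ^ 2 := pow_le_pow_left₀ hr0 hr 2
  have h3 : t ^ 2 ≤ 1 := pow_le_one₀ h0 hx.le
  nlinarith [mul_nonneg (sq_nonneg (1 - t)) (sq_nonneg t),
    mul_nonneg (sq_nonneg r) (sub_nonneg.2 h3)]

/-- Removing from `closure Ω` neighbourhoods of caps that cover its ideal points leaves a compact
subset of the ball. There the sum of the barriers, plus a small multiple of a strict supersolution,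
dominates `u / M`: on `∂Ω` because `u = 0`, on the boundaries of the removed neighbourhoods because
one of the barriers is at least `1`, and elsewhere by comparison. -/
theorem le_mul_sum_capBarrier {Ω : Set (EuclideanSpace ℝ (Fin n))} (hΩ : Ω ⊆ Metric.ball 0 1)
    (hΩ_open : IsOpen Ω) {u : EuclideanSpace ℝ (Fin n) → ℝ} {lam M s : ℝ}
    (hsn : 2 * s = n - 1) (hs : 0 ≤ s) (hlam : lam ≤ s ^ 2)
    (hcont : ContinuousOn u (closure Ω ∩ Metric.ball 0 1)) (hC2 : ContDiffOn ℝ 2 u Ω)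
    (heq : ∀ x ∈ Ω, -hypLaplacian u x = lam * u x)
    (hbdry : ∀ x ∈ frontier Ω ∩ Metric.ball 0 1, u x = 0)
    (hM : 0 < M) (huM : ∀ x ∈ Ω, u x ≤ M)
    {F : Finset ℕ} {ξ : ℕ → EuclideanSpace ℝ (Fin n)} {r : ℕ → ℝ}
    (hF : ∀ i ∈ F, ‖ξ i‖ = 1 ∧ 0 < r i ∧ r i ≤ 1)
    (hcover : closure Ω ∩ Metric.sphere 0 1 ⊆ ⋃ i ∈ F, Metric.ball (ξ i) (r i))
    {x₀ : EuclideanSpace ℝ (Fin n)} (hx₀ : x₀ ∈ Ω)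
    (hx₀F : ∀ i ∈ F, barrierRatio s * r i ≤ capFunction (ξ i) (r i) x₀) :
    u x₀ ≤ M * ∑ i ∈ F, capBarrier s (ξ i) (r i) x₀ := by
  set S : Set (EuclideanSpace ℝ (Fin n)) := closure Ω \ ⋃ i ∈ F, capNhd s (ξ i) (r i) with hS
  have hclΩ : closure Ω ⊆ Metric.closedBall 0 1 :=
    closure_minimal (hΩ.trans Metric.ball_subset_closedBall) Metric.isClosed_closedBall
  have hSc : IsCompact S :=
    ((isCompact_closedBall (0 : EuclideanSpace ℝ (Fin n)) 1).of_isClosed_subset isClosed_closure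
      hclΩ).diff (isOpen_biUnion fun i _ => isOpen_capNhd s (ξ i) (r i))
  have hSB : S ⊆ Metric.ball 0 1 := fun y hy => by
    by_contra hyb
    have hy1 : ‖y‖ = 1 := le_antisymm (mem_closedBall_zero_iff.1 (hclΩ hy.1))
      (not_lt.1 fun h => hyb (mem_ball_zero_iff.2 h))
    obtain ⟨i, hi, hyi⟩ := Set.mem_iUnion₂.1 (hcover ⟨hy.1, mem_sphere_zero_iff_norm.2 hy1⟩)
    exact hy.2 (Set.mem_iUnion₂.2 ⟨i, hi, mem_capNhd_of_mem_ball (hF i hi).1 hy1 hyi⟩)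
  have hnorm : ∀ y ∈ S, ‖y‖ < 1 := fun y hy => mem_ball_zero_iff.1 (hSB hy)
  have hτ : ∀ y ∈ S, ∀ i ∈ F, barrierRatio s * r i ≤ capFunction (ξ i) (r i) y :=
    fun y hy i hi => (notMem_capNhd_iff (hnorm y hy)).1
      fun h => hy.2 (Set.mem_iUnion₂.2 ⟨i, hi, h⟩)
  have hx₀S : x₀ ∈ S := ⟨subset_closure hx₀, fun h => by
    obtain ⟨i, hi, h⟩ := Set.mem_iUnion₂.1 h
    exact (notMem_capNhd_iff (mem_ball_zero_iff.1 (hΩ hx₀))).2 (hx₀F i hi) h⟩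
  obtain ⟨C, hC0, hC⟩ := exists_centralBarrier_pos hSc hSB s
  have hsum0 : ∀ y ∈ S, 0 ≤ ∑ i ∈ F, capBarrier s (ξ i) (r i) y := fun y hy =>
    Finset.sum_nonneg fun i hi => (capBarrier_pos hs (hF i hi).2.1 (hτ y hy i hi)).le
  -- the strict supersolution enters with a weight `η` that tends to `0` in the end
  have main : ∀ η : ℝ, 0 < η → u x₀ ≤
      M * (∑ i ∈ F, capBarrier s (ξ i) (r i) x₀ + η * centralBarrier s C x₀) := by
    intro η hη
    have hcd : ∀ y ∈ S, ∀ i ∈ F, ContDiffAt ℝ 2 (capBarrier s (ξ i) (r i)) y := fun y hy i hi =>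
      contDiffAt_capBarrier s _ _ (hnorm y hy)
        (capFunction_pos_of_le hs (hF i hi).2.1 (hτ y hy i hi))
    have hcds : ∀ y ∈ S, ContDiffAt ℝ 2 (fun y => ∑ i ∈ F, capBarrier s (ξ i) (r i) y) y :=
      fun y hy => ContDiffAt.sum fun i hi => hcd y hy i hi
    have hcdc : ∀ y ∈ S, ContDiffAt ℝ 2 (fun y => η * centralBarrier s C y) y := fun y hy =>
      contDiffAt_const.mul (contDiffAt_centralBarrier s C (hnorm y hy))
    have hvpos : ∀ y ∈ S,
        0 < ∑ i ∈ F, capBarrier s (ξ i) (r i) y + η * centralBarrier s C y := fun y hy =>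
      add_pos_of_nonneg_of_pos (hsum0 y hy) (mul_pos hη (hC y hy))
    refine le_mul_of_strict_supersolution hSc hSB
      (hcont.mono fun y hy => ⟨hy.1, hSB hy⟩)
      (fun y hy => ((hcds y hy).add (hcdc y hy)).continuousAt.continuousWithinAt)
      hvpos hlam hM.le (fun y hy => ?_) x₀ hx₀S
    have hMv := mul_pos hM (hvpos y hy)
    by_cases hyΩ : y ∈ Ω
    swap
    · left
      rw [hbdry y ⟨⟨hy.1, by rwa [hΩ_open.interior_eq]⟩, hSB hy⟩]
      exact hMv.le
    by_cases hstrict : ∀ i ∈ F, barrierRatio s * r i < capFunction (ξ i) (r i) y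
    · right
      refine ⟨?_, (hC2 y hyΩ).contDiffAt (hΩ_open.mem_nhds hyΩ), (hcds y hy).add (hcdc y hy),
        heq y hyΩ, ?_⟩
      · have hev : ∀ᶠ z in 𝓝 y, ∀ i ∈ F, barrierRatio s * r i < capFunction (ξ i) (r i) z :=
          (Filter.eventually_all_finset F).2 fun i hi =>
            (contDiffAt_minkowskiLinear _ _ (hnorm y hy)).continuousAt.eventually_const_lt
              (hstrict i hi)
        filter_upwards [hev, hΩ_open.mem_nhds hyΩ] with z hz hzΩ
        refine ⟨subset_closure hzΩ, fun h => ?_⟩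
        obtain ⟨i, hi, h⟩ := Set.mem_iUnion₂.1 h
        exact (notMem_capNhd_iff (mem_ball_zero_iff.1 (hΩ hzΩ))).2 (hz i hi).le h
      · rw [hypLaplacian_add (hnorm y hy) (hcds y hy) (hcdc y hy),
          hypLaplacian_sum F (hnorm y hy) (hcd y hy),
          hypLaplacian_const_mul (hnorm y hy) (contDiffAt_centralBarrier s C (hnorm y hy))]
        have h1 : ∑ i ∈ F, (hypLaplacian (capBarrier s (ξ i) (r i)) y +
            s ^ 2 * capBarrier s (ξ i) (r i) y) ≤ 0 := Finset.sum_nonpos fun i hi =>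
          hypLaplacian_capBarrier_add_le hsn hs (hF i hi).2.1 (hF i hi).2.2 (hF i hi).1
            (hnorm y hy) (hτ y hy i hi)
        rw [Finset.sum_add_distrib, ← Finset.mul_sum] at h1
        have h2 := mul_neg_of_pos_of_neg hη
          (hypLaplacian_centralBarrier_add_lt hsn hs hC0 (hnorm y hy))
        linarith
    · left
      push Not at hstrict
      obtain ⟨i, hi, hle⟩ := hstrict
      have h1 : 1 ≤ capBarrier s (ξ i) (r i) y :=
        one_le_capBarrier hs (hF i hi).2.1 (le_antisymm hle (hτ y hy i hi))
      have h2 : capBarrier s (ξ i) (r i) y ≤ ∑ i ∈ F, capBarrier s (ξ i) (r i) y :=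
        Finset.single_le_sum (f := fun i => capBarrier s (ξ i) (r i) y)
          (fun j hj => (capBarrier_pos hs (hF j hj).2.1 (hτ y hy j hj)).le) hi
      have h3 := mul_pos hη (hC y hy)
      exact (huM y hyΩ).trans (le_mul_of_one_le_right hM.le (by linarith))
  refine le_of_forall_pos_le_add fun e he => ?_
  have hc := hC x₀ hx₀S
  refine (main (e / (M * centralBarrier s C x₀)) (by positivity)).trans_eq ?_
  field_simp

/-- The barriers of caps of radii `r i` sum up to at most a constant times `∑ r i ^ s` at a fixed
point `x₀`, and this sum is arbitrarily small. -/
theorem nonpos_of_bddAbove {Ω : Set (EuclideanSpace ℝ (Fin n))} (hΩ : Ω ⊆ Metric.ball 0 1)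
    (hΩ_open : IsOpen Ω) {u : EuclideanSpace ℝ (Fin n) → ℝ} {lam M s : ℝ}
    (hsn : 2 * s = n - 1) (hs : 0 ≤ s) (hlam : lam ≤ s ^ 2)
    (hnull : Measure.hausdorffMeasure s (closure Ω ∩ Metric.sphere 0 1) = 0)
    (hcont : ContinuousOn u (closure Ω ∩ Metric.ball 0 1)) (hC2 : ContDiffOn ℝ 2 u Ω)
    (heq : ∀ x ∈ Ω, -hypLaplacian u x = lam * u x)
    (hbdry : ∀ x ∈ frontier Ω ∩ Metric.ball 0 1, u x = 0)
    (huM : ∀ x ∈ Ω, u x ≤ M) {x₀ : EuclideanSpace ℝ (Fin n)} (hx₀ : x₀ ∈ Ω) : u x₀ ≤ 0 := by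
  by_contra! hpos
  have hM : 0 < M := hpos.trans_le (huM x₀ hx₀)
  have hx₀1 : ‖x₀‖ < 1 := mem_ball_zero_iff.1 (hΩ hx₀)
  have hd : 0 < 1 - ‖x₀‖ := sub_pos.2 hx₀1
  set d := 1 - ‖x₀‖ with hd_def
  have hA := one_le_barrierRatio hs
  have hA0 : 0 < barrierRatio s := one_pos.trans_le hA
  have hK : IsCompact (closure Ω ∩ Metric.sphere 0 1) :=
    (isCompact_sphere _ _).inter_left isClosed_closure
  set c := 2 * barrierRatio s ^ s * (d ^ 2 / 2) ^ (-s) with hc_def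
  have hc : 0 < c := mul_pos (mul_pos two_pos (Real.rpow_pos_of_pos hA0 _))
    (Real.rpow_pos_of_pos (by positivity) _)
  obtain ⟨F, ξ, r, hF, hcover, hsum⟩ := exists_finite_ball_cover hs hK hnull
    (ε := u x₀ / (M * c)) (δ := min 1 (min (d / 2) (d ^ 2 / (2 * barrierRatio s))))
    (by positivity) (by positivity)
  have hξ : ∀ i ∈ F, ‖ξ i‖ = 1 := fun i hi => mem_sphere_zero_iff_norm.1 (hF i hi).1.2
  have hr : ∀ i ∈ F, 0 < r i ∧ r i ≤ 1 ∧ r i ≤ d / 2 ∧ barrierRatio s * r i ≤ d ^ 2 / 2 :=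
    fun i hi => by
      obtain ⟨h1, h2⟩ := lt_min_iff.1 (hF i hi).2.2
      obtain ⟨h3, h4⟩ := lt_min_iff.1 h2
      refine ⟨(hF i hi).2.1, h1.le, h3.le, ?_⟩
      rw [lt_div_iff₀ (by positivity)] at h4
      linarith
  have hcap : ∀ i ∈ F, d ^ 2 / 2 ≤ capFunction (ξ i) (r i) x₀ := fun i hi =>
    le_capFunction (hξ i hi) hx₀1 (hr i hi).1.le (hr i hi).2.2.1
  have h1 := le_mul_sum_capBarrier hΩ hΩ_open hsn hs hlam hcont hC2 heq hbdry hM huM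
    (fun i hi => ⟨hξ i hi, (hr i hi).1, (hr i hi).2.1⟩) hcover hx₀
    (fun i hi => (hr i hi).2.2.2.trans (hcap i hi))
  have h2 : ∑ i ∈ F, capBarrier s (ξ i) (r i) x₀ ≤ ∑ i ∈ F, c * r i ^ s := by
    refine Finset.sum_le_sum fun i hi => ?_
    have hd2 : 0 < d ^ 2 / 2 := by positivity
    refine (capBarrier_le hs (hr i hi).1 (hd2.trans_le (hcap i hi))).trans ?_
    have h3 := Real.rpow_le_rpow_of_nonpos hd2 (hcap i hi) (neg_nonpos.2 hs)
    have h4 : 0 ≤ r i ^ s := Real.rpow_nonneg (hr i hi).1.le _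
    rw [hc_def]
    gcongr
  rw [← Finset.mul_sum] at h2
  have h3 := mul_lt_mul_of_pos_left hsum (mul_pos hM hc)
  rw [mul_div_cancel₀ _ (by positivity)] at h3
  have h4 := mul_le_mul_of_nonneg_left h2 hM.le
  linarith

end PoincareBall

theorem theorem1 (n : ℕ) (hn : 1 ≤ n)
    (Ω : Set (EuclideanSpace ℝ (Fin n))) (hΩ : Ω ⊆ Metric.ball 0 1)
    (hΩ_open : IsOpen Ω) (hΩ_conn : IsConnected Ω)
    (hΩ_null : MeasureTheory.Measure.hausdorffMeasure (((n : ℝ) - 1) / 2)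
      (PoincareBall.asymptoticBoundary Ω) = 0)
    (lam : ℝ) (hlam : lam ∈ Set.Icc (0 : ℝ) (((n : ℝ) - 1) ^ 2 / 4)) :
    ¬ ∃ u : EuclideanSpace ℝ (Fin n) → ℝ,
      PoincareBall.IsLambdaHarmonic Ω lam u ∧ ∃ M : ℝ, ∀ x ∈ Ω, |u x| ≤ M := by
  rintro ⟨u, hu, M, hM⟩
  obtain ⟨x₀, hx₀, hne⟩ := hu.nontrivial
  have hn1 : (1 : ℝ) ≤ n := by exact_mod_cast hn
  have hs : 0 ≤ ((n : ℝ) - 1) / 2 := by linarith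
  have hsn : 2 * (((n : ℝ) - 1) / 2) = n - 1 := by ring
  have hlam' : lam ≤ (((n : ℝ) - 1) / 2) ^ 2 := hlam.2.trans_eq (by ring)
  rw [PoincareBall.asymptoticBoundary_eq hΩ] at hΩ_null
  refine hne (le_antisymm ?_ ?_)
  · exact PoincareBall.nonpos_of_bddAbove hΩ hΩ_open hsn hs hlam' hΩ_null hu.continuousOn
      hu.contDiffOn hu.equation hu.boundary (fun x hx => (abs_le.1 (hM x hx)).2) hx₀
  · have h := PoincareBall.nonpos_of_bddAbove (u := fun x => -1 * u x) (M := M) hΩ hΩ_open hsn hs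
      hlam' hΩ_null (continuousOn_const.mul hu.continuousOn) (contDiffOn_const.mul hu.contDiffOn)
      (fun x hx => ?_) (fun x hx => by simp [hu.boundary x hx])
      (fun x hx => by linarith [(abs_le.1 (hM x hx)).1]) hx₀
    · linarith
    · rw [PoincareBall.hypLaplacian_const_mul (mem_ball_zero_iff.1 (hΩ hx))
        ((hu.contDiffOn x hx).contDiffAt (hΩ_open.mem_nhds hx))]
      linarith [hu.equation x hx]
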